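/- Let $\Delta$ be a Dedekind domain and let $G$ be a finitely generated subgroup of $\mathrm{GL}(n,\Delta)$. For a maximal ideal $\rho$ of $\Delta$, let $\phi_\rho:\mathrm{GL}(n,\Delta)\to\mathrm{GL}(n,\Delta/\rho)$ be the group homomorphism given by entrywise reduction modulo $\rho$. Let $\nu$ be a positive integer. Then for all but finitely many maximal ideals $\rho$ of $\Delta$ (the finite set of exceptions may depend on $\nu$) the following hold: (i) if $G$ is finite, then $\phi_\rho$ restricts to an isomorphism of $G$ onto $\phi_\rho(G)$; (ii) if $G$ is infinite, then $\phi_\rho(G)$ contains an element of order greater than $\nu$, where an element of infinite order is regarded as having order greater than $\nu$. -/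

import Mathlib

/-- The congruence homomorphism `φ_ρ : GL(n, Δ) → GL(n, Δ/ρ)` of an ideal `ρ` of `Δ`:
entrywise reduction modulo `ρ`. -/
def congruenceHom {Δ : Type*} [CommRing Δ] (n : ℕ) (ρ : Ideal Δ) :
    GL (Fin n) Δ →* GL (Fin n) (Δ ⧸ ρ) :=
  Matrix.GeneralLinearGroup.map (Ideal.Quotient.mk ρ)

/-- The order of `h` exceeds `ν`. An element of infinite order counts as exceeding every `ν`
(Mathlib's `orderOf` takes the value `0` at such an element). -/
def OrderGreaterThan {H : Type*} [Group H] (h : H) (ν : ℕ) : Prop :=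
  ¬ IsOfFinOrder h ∨ ν < orderOf h

/-!
For `g ≠ 1` in `GL(n, Δ)` some entry of `g - 1` is nonzero, and in a Dedekind domain a nonzero
element lies in only finitely many maximal ideals; so `φ_ρ g ≠ 1` for almost all `ρ`
(`finite_setOf_congruenceHom_eq_one`). If `G` is finite, apply this to its finitely many
nonidentity elements. If `G` is infinite, it is enough to find one `g ∈ G` whose powers
`g, g², …, g^ν` are all different from `1`, and to apply this to those powers.

That such a `g` exists is Burnside's theorem: a finitely generated linear group of finite exponent
is finite (`Representation.finite_of_injective_of_pow_eq_one`). After passing to an algebraically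
closed field `k`, the proof is by induction on the dimension of the representation
(`Representation.finiteIndex_ker_of_pow_eq_one`).

* If the representation is irreducible, Schur's lemma and the Jacobson density theorem show that
  the operators `ρ g` span `End V`, so that `ρ g` is determined by the traces of `ρ (g * s)`, with
  `s` in a finite set of group elements whose images span. Each trace is a sum of `dim V` roots of
  unity of order dividing the exponent, so there are only finitely many values.
* If `W` is a proper nonzero invariant subspace, a subgroup `K` of finite index acts trivially on
  `W` and on `V ⧸ W`. The operators `ρ g`, `g ∈ K`, commute, since `(ρ g - 1) * (ρ h - 1) = 0`. By
  Schreier's lemma `K` is finitely generated, so `ρ(K)` is a finitely generated abelian torsion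
  group, which is finite.
-/

/-! ### Endomorphisms of finite order and the trace form -/

namespace Module.End

variable {k V : Type*} [Field k] [AddCommGroup V] [Module k V] [FiniteDimensional k V]

/-- The trace is the sum of the `dim V` eigenvalues, which are `N`-th roots of unity. -/
theorem finite_setOf_trace_of_pow_eq_one [IsAlgClosed k] {N : ℕ} (hN : 0 < N) :
    {t : k | ∃ f : Module.End k V, f ^ N = 1 ∧ LinearMap.trace k V f = t}.Finite := by
  classical
  let S : Multiset k := Module.finrank k V • (Polynomial.nthRootsFinset N (1 : k)).val
  refine ((Set.finite_Iic S).image Multiset.sum).subset ?_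
  rintro _ ⟨f, hf, rfl⟩
  refine ⟨f.charpoly.roots, ?_,
    (trace_eq_sum_roots_charpoly_of_splits (IsAlgClosed.splits _)).symm⟩
  rw [Set.mem_Iic, Multiset.le_iff_count]
  intro a
  by_cases ha : a ∈ f.charpoly.roots
  · have hroot : f.HasEigenvalue a :=
      (hasEigenvalue_iff_isRoot_charpoly f a).2 (Polynomial.isRoot_of_mem_roots ha)
    have haN : a ^ N = 1 := by
      obtain ⟨v, hv⟩ := hroot.exists_hasEigenvector
      have h := hv.pow_apply N
      rw [hf, one_apply] at h
      have h' : (a ^ N - 1) • v = 0 := by rw [sub_smul, ← h, one_smul, sub_self]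
      exact sub_eq_zero.1 ((smul_eq_zero.1 h').resolve_right hv.2)
    have hmem : a ∈ (Polynomial.nthRootsFinset N (1 : k)).val :=
      (Polynomial.mem_nthRootsFinset hN 1).2 haN
    calc Multiset.count a f.charpoly.roots ≤ Multiset.card f.charpoly.roots :=
          Multiset.count_le_card _ _
      _ ≤ f.charpoly.natDegree := Polynomial.card_roots' _
      _ = Module.finrank k V * 1 := by rw [LinearMap.charpoly_natDegree, mul_one]
      _ ≤ Multiset.count a S := by
          rw [Multiset.count_nsmul]
          exact Nat.mul_le_mul_left _ (Multiset.one_le_count_iff_mem.2 hmem)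
  · rw [Multiset.count_eq_zero_of_notMem ha]
    exact Nat.zero_le _

/-- The trace form on `End V` is nondegenerate. -/
theorem eq_of_forall_trace_mul_eq {a b : Module.End k V}
    (h : ∀ x : Module.End k V, LinearMap.trace k V (a * x) = LinearMap.trace k V (b * x)) :
    a = b := by
  ext v
  refine (Module.forall_dual_apply_eq_zero_iff k _).1 (fun φ ↦ ?_) |> sub_eq_zero.1
  -- test against the rank one operators `φ(·) v`
  have key : ∀ c : Module.End k V, c * φ.smulRight v = φ.smulRight (c v) := by
    intro c; ext w; simp
  have := h (φ.smulRight v)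
  rw [key, key, LinearMap.trace_smulRight, LinearMap.trace_smulRight] at this
  rw [map_sub, this, sub_self]

end Module.End

/-! ### Burnside's theorem on linear groups of finite exponent -/

namespace Representation

variable {k G : Type*} {V : Type*} [Field k] [Group G] [AddCommGroup V] [Module k V]

/-- Burnside's theorem on irreducible representations over an algebraically closed field. -/
theorem asAlgebraHom_surjective_of_isIrreducible [IsAlgClosed k] [FiniteDimensional k V]
    (ρ : Representation k G V) [ρ.IsIrreducible] :
    Function.Surjective ρ.asAlgebraHom := by
  intro f
  have hend : ∀ c : Module.End (MonoidAlgebra k G) ρ.asModule, ∃ t : k, ∀ v, c v = t • v := by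
    intro c
    obtain ⟨t, ht⟩ := (IsSimpleModule.algebraMap_end_bijective_of_isAlgClosed
      (A := MonoidAlgebra k G) (V := ρ.asModule) k).2 c
    exact ⟨t, fun v ↦ by rw [← ht]; rfl⟩
  -- by Schur's lemma, every `k`-linear map commutes with the `G`-equivariant endomorphisms
  let F : Module.End (Module.End (MonoidAlgebra k G) ρ.asModule) ρ.asModule :=
    { toFun := fun v ↦ ρ.asModuleEquiv.symm (f (ρ.asModuleEquiv v))
      map_add' := fun v w ↦ by simp
      map_smul' := fun c v ↦ by
        obtain ⟨t, ht⟩ := hend c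
        simp only [Module.End.smul_def, ht, map_smul, RingHom.id_apply] }
  let b := Module.finBasis k V
  obtain ⟨r, hr⟩ := jacobson_density (R := MonoidAlgebra k G) F
    (Finset.univ.map ⟨fun i ↦ ρ.asModuleEquiv.symm (b i),
      ρ.asModuleEquiv.symm.injective.comp b.injective⟩)
  refine ⟨r, b.ext fun i ↦ ?_⟩
  have := congrArg ρ.asModuleEquiv
    (hr _ (Finset.mem_map_of_mem _ (Finset.mem_univ i)))
  rw [asModuleEquiv_map_smul] at this
  simpa [F] using this.symm

theorem finiteIndex_ker_of_finite_range (ρ : Representation k G V) (h : (Set.range ρ).Finite) :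
    ρ.ker.FiniteIndex := by
  rw [← MonoidHom.ker_toHomUnits]
  have : Finite ρ.toHomUnits.range := by
    have := h.to_subtype
    refine Finite.of_injective
      (fun u : ρ.toHomUnits.range ↦ (⟨(u.1 : Module.End k V), ?_⟩ : Set.range ρ)) ?_
    · obtain ⟨g, hg⟩ := u.2
      exact ⟨g, by rw [← hg]; rfl⟩
    · intro u v huv
      exact Subtype.ext (Units.ext (congrArg Subtype.val huv))
  infer_instance

theorem finiteIndex_ker_of_isIrreducible [IsAlgClosed k] [FiniteDimensional k V]
    (ρ : Representation k G V) [ρ.IsIrreducible] {N : ℕ} (hN : 0 < N)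
    (hexp : ∀ g : G, g ^ N = 1) : ρ.ker.FiniteIndex := by
  classical
  refine ρ.finiteIndex_ker_of_finite_range ?_
  have hspan : Submodule.span k (Set.range ρ) = ⊤ := by
    rw [eq_top_iff]
    intro f _
    obtain ⟨r, rfl⟩ := ρ.asAlgebraHom_surjective_of_isIrreducible f
    induction r using MonoidAlgebra.induction_linear with
    | zero => simp
    | add x y hx hy => rw [map_add]; exact add_mem (hx Submodule.mem_top) (hy Submodule.mem_top)
    | single g a =>
      rw [asAlgebraHom_single]
      exact Submodule.smul_mem _ _ (Submodule.subset_span ⟨g, rfl⟩)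
  obtain ⟨s, hs, hs'⟩ := Submodule.fg_span_iff_fg_span_finset_subset (R := k) (Set.range ρ) |>.1
    (hspan ▸ Module.Finite.fg_top)
  let T : Module.End k V → (s → k) := fun f x ↦ LinearMap.trace k V (f * x)
  refine Set.Finite.of_finite_image (f := T) ?_ ?_
  · refine (Set.Finite.pi' fun _ : s ↦
      Module.End.finite_setOf_trace_of_pow_eq_one (k := k) (V := V) hN).subset ?_
    rintro _ ⟨_, ⟨g, rfl⟩, rfl⟩ x
    obtain ⟨h, hh⟩ := hs x.2
    exact ⟨ρ (g * h), by rw [← map_pow, hexp, map_one], by simp [T, hh]⟩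
  · intro a _ b _ hab
    refine Module.End.eq_of_forall_trace_mul_eq fun x ↦ ?_
    have hx : x ∈ Submodule.span k (s : Set (Module.End k V)) := by
      rw [← hs', hspan]; trivial
    induction hx using Submodule.span_induction with
    | mem x hx => exact congrFun hab ⟨x, hx⟩
    | zero => simp
    | add x y _ _ hx hy => rw [mul_add, mul_add, map_add, map_add, hx, hy]
    | smul t x _ hx => rw [mul_smul_comm, mul_smul_comm, map_smul, map_smul, hx]

/-- If `ρ g` and `ρ h` are trivial on `W` and on `V ⧸ W`, then `(ρ g - 1) * (ρ h - 1) = 0`. -/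
theorem commute_of_mem_ker_subrepresentation_of_mem_ker_quotient (ρ : Representation k G V)
    (W : Submodule k V) (hW : ∀ g, W ≤ W.comap (ρ g)) {g h : G}
    (hg : g ∈ (ρ.subrepresentation W hW).ker ⊓ (ρ.quotient W hW).ker)
    (hh : h ∈ (ρ.subrepresentation W hW).ker ⊓ (ρ.quotient W hW).ker) :
    Commute (ρ g) (ρ h) := by
  have hsub : ∀ {x : G}, x ∈ (ρ.subrepresentation W hW).ker → ∀ w ∈ W, ρ x w = w := by
    intro x hx w hw
    have := LinearMap.congr_fun (MonoidHom.mem_ker.1 hx) ⟨w, hw⟩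
    simpa using congrArg Subtype.val this
  have hquo : ∀ {x : G}, x ∈ (ρ.quotient W hW).ker → ∀ v, ρ x v - v ∈ W := by
    intro x hx v
    have := LinearMap.congr_fun (MonoidHom.mem_ker.1 hx) (W.mkQ v)
    rw [← Submodule.Quotient.eq]
    simpa using this
  ext v
  have h1 := hsub hg.1 _ (hquo hh.2 v)
  have h2 := hsub hh.1 _ (hquo hg.2 v)
  rw [map_sub, sub_eq_iff_eq_add] at h1 h2
  rw [Module.End.mul_apply, Module.End.mul_apply, h1, h2]
  abel

/-- The image is a finitely generated abelian torsion group. -/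
theorem finiteIndex_ker_of_commute [Group.FG G] (ρ : Representation k G V)
    (hcomm : ∀ g h : G, Commute (ρ g) (ρ h)) {N : ℕ} (hN : 0 < N)
    (hexp : ∀ g : G, g ^ N = 1) : ρ.ker.FiniteIndex := by
  rw [← MonoidHom.ker_toHomUnits]
  let _ : CommGroup ρ.toHomUnits.range :=
    { (inferInstance : Group ρ.toHomUnits.range) with
      mul_comm := by
        rintro ⟨_, g, rfl⟩ ⟨_, h, rfl⟩
        exact Subtype.ext (Units.ext (hcomm g h)) }
  have : Finite ρ.toHomUnits.range := by
    refine CommGroup.finite_of_fg_isMulTorsion _ ?_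
    rintro ⟨_, g, rfl⟩
    refine isOfFinOrder_iff_pow_eq_one.2 ⟨N, hN, Subtype.ext ?_⟩
    change ρ.toHomUnits g ^ N = 1
    rw [← map_pow, hexp, map_one]
  infer_instance

/-- The induction step: a proper nonzero invariant subspace reduces the claim to two
representations and to a subgroup of finite index with commutative image. -/
theorem finiteIndex_ker_of_subrepresentation_of_quotient [Group.FG G] (ρ : Representation k G V)
    (W : Submodule k V) (hW : ∀ g, W ≤ W.comap (ρ g))
    (hsub : (ρ.subrepresentation W hW).ker.FiniteIndex)
    (hquo : (ρ.quotient W hW).ker.FiniteIndex) {N : ℕ} (hN : 0 < N)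
    (hexp : ∀ g : G, g ^ N = 1) : ρ.ker.FiniteIndex := by
  set K : Subgroup G := (ρ.subrepresentation W hW).ker ⊓ (ρ.quotient W hW).ker with hK
  have hle : ρ.ker ≤ K := by
    intro g hg
    rw [MonoidHom.mem_ker] at hg
    refine ⟨MonoidHom.mem_ker.2 ?_, MonoidHom.mem_ker.2 ?_⟩
    · ext w; simp [hg]
    · ext v; simp [hg]
  have hKfin : K.FiniteIndex := inferInstance
  have hres : (MonoidHom.ker (ρ.comp K.subtype)).FiniteIndex :=
    finiteIndex_ker_of_commute (ρ.comp K.subtype)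
      (fun g h ↦ ρ.commute_of_mem_ker_subrepresentation_of_mem_ker_quotient W hW g.2 h.2) hN
      (fun g ↦ Subtype.ext (hexp g))
  refine ⟨?_⟩
  rw [← Subgroup.relIndex_mul_index hle]
  exact mul_ne_zero hres.index_ne_zero hKfin.index_ne_zero

theorem finiteIndex_ker_of_pow_eq_one [IsAlgClosed k] [FiniteDimensional k V] [Group.FG G]
    (ρ : Representation k G V) {N : ℕ} (hN : 0 < N) (hexp : ∀ g : G, g ^ N = 1) :
    ρ.ker.FiniteIndex := by
  induction hd : Module.finrank k V using Nat.strong_induction_on generalizing V with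
  | _ d ih =>
    subst hd
    rcases subsingleton_or_nontrivial V with hV | hV
    · have : ρ.ker = ⊤ := eq_top_iff.2 fun g _ ↦ MonoidHom.mem_ker.2 (Subsingleton.elim _ _)
      rw [this]
      infer_instance
    by_cases hirr : ∀ W : Submodule k V, (∀ g, W ≤ W.comap (ρ g)) → W = ⊥ ∨ W = ⊤
    · have : Nontrivial (Subrepresentation ρ) := by
        refine ⟨⊥, ⊤, fun h ↦ ?_⟩
        exact bot_ne_top (α := Submodule k V) (congrArg Subrepresentation.toSubmodule h)
      have : ρ.IsIrreducible :=
        { eq_bot_or_eq_top := fun σ ↦ (hirr σ.toSubmodule σ.apply_mem_toSubmodule).imp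
            (fun h ↦ Subrepresentation.toSubmodule_injective h)
            (fun h ↦ Subrepresentation.toSubmodule_injective h) }
      exact ρ.finiteIndex_ker_of_isIrreducible hN hexp
    · push Not at hirr
      obtain ⟨W, hW, hbot, htop⟩ := hirr
      have hlt : Module.finrank k W < Module.finrank k V := Submodule.finrank_lt htop
      have hlt' : Module.finrank k (V ⧸ W) < Module.finrank k V := by
        have h1 := W.finrank_quotient_add_finrank
        have h2 : Module.finrank k W ≠ 0 := fun h ↦ hbot (Submodule.finrank_eq_zero.1 h)
        omega
      exact ρ.finiteIndex_ker_of_subrepresentation_of_quotient W hW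
        (ih _ hlt _ rfl) (ih _ hlt' _ rfl) hN hexp

/-- **Burnside's theorem**: a finitely generated linear group of finite exponent is finite. -/
theorem finite_of_injective_of_pow_eq_one [IsAlgClosed k] [FiniteDimensional k V] [Group.FG G]
    (ρ : Representation k G V) (hρ : Function.Injective ρ) {N : ℕ} (hN : 0 < N)
    (hexp : ∀ g : G, g ^ N = 1) : Finite G := by
  have h := ρ.finiteIndex_ker_of_pow_eq_one hN hexp
  rw [(MonoidHom.ker_eq_bot_iff ρ).2 hρ] at h
  exact Subgroup.finite_iff_finite_and_finiteIndex (H := (⊥ : Subgroup G)) |>.2 ⟨inferInstance, h⟩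

end Representation

/-- Burnside's theorem for matrices over a domain `Δ`, by embedding `Δ` into the algebraic closure
of its field of fractions. -/
theorem Matrix.GeneralLinearGroup.finite_of_fg_of_pow_eq_one {Δ : Type*} [CommRing Δ] [IsDomain Δ]
    {n : ℕ} (G : Subgroup (GL (Fin n) Δ)) (hG : G.FG) {N : ℕ} (hN : 0 < N)
    (hexp : ∀ g ∈ G, g ^ N = 1) : Finite G := by
  let k := AlgebraicClosure (FractionRing Δ)
  let i : Δ →+* k := (algebraMap (FractionRing Δ) k).comp (algebraMap Δ (FractionRing Δ))
  have hi : Function.Injective i :=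
    (algebraMap (FractionRing Δ) k).injective.comp (IsFractionRing.injective Δ (FractionRing Δ))
  let ρ : Representation k G (Fin n → k) :=
    ((Matrix.toLinAlgEquiv' : Matrix (Fin n) (Fin n) k ≃ₐ[k] _) : _ →* _).comp
      ((i.mapMatrix : Matrix (Fin n) (Fin n) Δ →+* _).toMonoidHom.comp
        ((Units.coeHom _).comp G.subtype))
  have hρ : Function.Injective ρ :=
    Matrix.toLinAlgEquiv'.injective.comp ((Matrix.map_injective hi).comp
      (Units.val_injective.comp Subtype.val_injective))
  have : Group.FG G := (Group.fg_iff_subgroup_fg G).2 hG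
  exact ρ.finite_of_injective_of_pow_eq_one hρ hN fun g ↦ Subtype.ext (hexp g g.2)

/-! ### Reduction modulo maximal ideals -/

theorem MaximalSpectrum.finite_setOf_mem {Δ : Type*} [CommRing Δ] [IsDedekindDomain Δ] {x : Δ}
    (hx : x ≠ 0) : {ρ : MaximalSpectrum Δ | x ∈ ρ.asIdeal}.Finite := by
  have hI : Ideal.span {x} ≠ 0 := by
    rwa [Ne, Ideal.zero_eq_bot, Ideal.span_singleton_eq_bot]
  refine Set.Finite.of_finite_image (f := MaximalSpectrum.asIdeal)
    (((Ideal.finite_factors hI).image IsDedekindDomain.HeightOneSpectrum.asIdeal).subset ?_)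
    fun ρ _ σ _ h ↦ MaximalSpectrum.ext h
  rintro _ ⟨ρ, hρ, rfl⟩
  refine ⟨⟨ρ.asIdeal, ρ.isMaximal.isPrime, ?_⟩, ?_, rfl⟩
  · rintro h
    exact hx (by simpa [h] using hρ)
  · exact Ideal.dvd_span_singleton.2 hρ

theorem finite_setOf_congruenceHom_eq_one {Δ : Type*} [CommRing Δ] [IsDedekindDomain Δ] {n : ℕ}
    {g : GL (Fin n) Δ} (hg : g ≠ 1) :
    {ρ : MaximalSpectrum Δ | congruenceHom n ρ.asIdeal g = 1}.Finite := by
  obtain ⟨i, j, hij⟩ : ∃ i j, g i j - (1 : Matrix (Fin n) (Fin n) Δ) i j ≠ 0 := by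
    by_contra! h
    exact hg (Units.ext (Matrix.ext fun i j ↦ sub_eq_zero.1 (h i j)))
  refine (MaximalSpectrum.finite_setOf_mem hij).subset fun ρ hρ ↦ ?_
  have h : Ideal.Quotient.mk ρ.asIdeal (g i j) =
      (1 : Matrix (Fin n) (Fin n) (Δ ⧸ ρ.asIdeal)) i j := by
    change (congruenceHom n ρ.asIdeal g) i j = _
    rw [show congruenceHom n ρ.asIdeal g = 1 from hρ, Units.val_one]
  rw [Set.mem_ofPred_eq, ← Ideal.Quotient.eq_zero_iff_mem, map_sub, h, sub_eq_zero]
  by_cases hij' : i = j <;> simp [Matrix.one_apply, hij']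

theorem mainTheorem4 {Δ : Type*} [CommRing Δ] [IsDedekindDomain Δ] (n : ℕ)
    (G : Subgroup (GL (Fin n) Δ)) (hG : G.FG) (ν : ℕ) :
    {ρ : MaximalSpectrum Δ |
      ¬ ((Finite G → Function.Bijective ((congruenceHom n ρ.asIdeal).subgroupMap G)) ∧
        (Infinite G →
          ∃ h ∈ G.map (congruenceHom n ρ.asIdeal), OrderGreaterThan h ν))}.Finite := by
  rcases finite_or_infinite G with hfin | hinf
  · have hbad : (⋃ g : {g : G // g.1 ≠ 1},
        {ρ : MaximalSpectrum Δ | congruenceHom n ρ.asIdeal g.1.1 = 1}).Finite :=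
      Set.finite_iUnion fun g ↦ finite_setOf_congruenceHom_eq_one g.2
    refine hbad.subset fun ρ hρ ↦ ?_
    by_contra hgood
    refine hρ ⟨fun _ ↦ ⟨?_, MonoidHom.subgroupMap_surjective _ _⟩,
      fun hinf ↦ (not_finite G).elim⟩
    rw [injective_iff_map_eq_one]
    intro g hg
    by_contra hne
    exact hgood (Set.mem_iUnion.2 ⟨⟨g, fun h ↦ hne (Subtype.ext h)⟩, congrArg Subtype.val hg⟩)
  · obtain ⟨g, hgG, hg⟩ : ∃ g ∈ G, ∀ m ∈ Finset.Icc 1 ν, g ^ m ≠ 1 := by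
      -- otherwise `ν!` is an exponent of `G`
      by_contra! h
      refine hinf.not_finite (Matrix.GeneralLinearGroup.finite_of_fg_of_pow_eq_one G hG
        ν.factorial_pos fun g hg ↦ ?_)
      obtain ⟨m, hm, hgm⟩ := h g hg
      rw [Finset.mem_Icc] at hm
      obtain ⟨c, hc⟩ := Nat.dvd_factorial hm.1 hm.2
      rw [hc, pow_mul, hgm, one_pow]
    have hbad : (⋃ m ∈ Finset.Icc 1 ν,
        {ρ : MaximalSpectrum Δ | congruenceHom n ρ.asIdeal (g ^ m) = 1}).Finite :=
      (Finset.Icc 1 ν).finite_toSet.biUnion fun m hm ↦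
        finite_setOf_congruenceHom_eq_one (hg m hm)
    refine hbad.subset fun ρ hρ ↦ ?_
    by_contra hgood
    refine hρ ⟨fun hfin ↦ (not_finite G).elim, fun _ ↦
      ⟨_, Subgroup.mem_map_of_mem _ hgG, ?_⟩⟩
    by_contra hord
    obtain ⟨hfo, hle⟩ : IsOfFinOrder (congruenceHom n ρ.asIdeal g) ∧
        orderOf (congruenceHom n ρ.asIdeal g) ≤ ν := by
      simpa [OrderGreaterThan] using hord
    refine hgood (Set.mem_iUnion₂.2 ⟨_, Finset.mem_Icc.2 ⟨hfo.orderOf_pos, hle⟩, ?_⟩)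
    rw [Set.mem_ofPred_eq, map_pow, pow_orderOf_eq_one]
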